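/- For a group $G$ let $\mathbb{Z}G$ be its integral group ring. The bicyclic units of $\mathbb{Z}G$ are the elements $$\beta_{x,h}=1+(1-h)x(1+h+\cdots+h^{d-1}),\qquad \gamma_{x,h}=1+(1+h+\cdots+h^{d-1})x(1-h),$$ where $x,h\in G$ and $h$ has finite order $d$. The Bass cyclic units of $\mathbb{Z}G$ are the elements $$u_{k,m}(x)=(1+x+\cdots+x^{k-1})^m+\frac{1-k^m}{d}(1+x+\cdots+x^{d-1}),$$ where $x\in G$ has finite order $d$ and $k,m$ are positive integers with $\gcd(k,d)=1$ and $\varphi(d)\mid m$, with $\varphi$ Euler's function. A pair $(u,v)$ of elements of a group is a free pair if the subgroup generated by $u$ and $v$ is a non-abelian free group. Theorem. Let $n\ge 0$ be an integer. The ring $\mathbb{Z}A_n$ contains a free pair (in its group of units) formed by a positive power of a bicyclic unit and a Bass cyclic unit if and only if $n\ge 5$. Likewise, $\mathbb{Z}S_n$ contains such a free pair if and only if $n\ge 5$. Moreover, in $A_5$ let $a=(1\,2)(3\,4)$, $b=(1\,3\,5)$ and $c=ba=(1\,2\,3\,4\,5)$ (permutations composed from right to left). Then $u_{2,4}(c)$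 and $\beta_{b,a}=1+(1-a)b(1+a)$ are units of $\mathbb{Z}A_5$, and there are positive integers $s,t$ such that $u_{2,4}(c)^s=u_{2,4s}(c)$ and $(\beta_{b,a}^{\,t},\,u_{2,4}(c)^s)$ is a free pair. -/

import Mathlib

noncomputable section

/-- The element `1 + g + g² + ⋯ + g^(k-1)` of the integral group ring `ℤG`. -/
def powerSum {G : Type*} [Group G] (g : G) (k : ℕ) : MonoidAlgebra ℤ G :=
  ∑ i ∈ Finset.range k, MonoidAlgebra.of ℤ G (g ^ i)

/-- `β_{x,h} = 1 + (1 - h) x (1 + h + ⋯ + h^(d-1))`, where `d` is the order of `h`. -/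
def bicyclicBeta {G : Type*} [Group G] (x h : G) : MonoidAlgebra ℤ G :=
  1 + (1 - MonoidAlgebra.of ℤ G h) * MonoidAlgebra.of ℤ G x * powerSum h (orderOf h)

/-- `γ_{x,h} = 1 + (1 + h + ⋯ + h^(d-1)) x (1 - h)`, where `d` is the order of `h`. -/
def bicyclicGamma {G : Type*} [Group G] (x h : G) : MonoidAlgebra ℤ G :=
  1 + powerSum h (orderOf h) * MonoidAlgebra.of ℤ G x * (1 - MonoidAlgebra.of ℤ G h)

/-- A bicyclic unit of `ℤG`, of either type. -/
def IsBicyclicUnit {G : Type*} [Group G] (v : (MonoidAlgebra ℤ G)ˣ) : Prop :=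
  ∃ x h : G, IsOfFinOrder h ∧
    ((v : MonoidAlgebra ℤ G) = bicyclicBeta x h ∨ (v : MonoidAlgebra ℤ G) = bicyclicGamma x h)

/-- `u_{k,m}(x) = (1 + x + ⋯ + x^(k-1))^m + ((1 - k^m)/d) (1 + x + ⋯ + x^(d-1))`, where `d` is the
order of `x`. It is used only when `k` is prime to `d` and `φ(d) ∣ m`, and then the integer
division is exact. -/
def bassCyclic {G : Type*} [Group G] (k m : ℕ) (x : G) : MonoidAlgebra ℤ G :=
  powerSum x k ^ m + ((1 - (k : ℤ) ^ m) / (orderOf x : ℤ)) • powerSum x (orderOf x)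

/-- A Bass cyclic unit of `ℤG`. -/
def IsBassCyclicUnit {G : Type*} [Group G] (u : (MonoidAlgebra ℤ G)ˣ) : Prop :=
  ∃ (x : G) (k m : ℕ), IsOfFinOrder x ∧ 0 < k ∧ 0 < m ∧ Nat.Coprime k (orderOf x) ∧
    Nat.totient (orderOf x) ∣ m ∧ (u : MonoidAlgebra ℤ G) = bassCyclic k m x

/-- `(u, v)` is a free pair: `u` and `v` generate a non-abelian free group. -/
def IsFreePair {Γ : Type*} [Group Γ] (u v : Γ) : Prop :=
  IsFreeGroup (Subgroup.closure ({u, v} : Set Γ)) ∧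
    ¬ IsMulCommutative (Subgroup.closure ({u, v} : Set Γ))

/-- `ℤG` contains a free pair formed by a power of a bicyclic unit and a Bass cyclic unit. -/
def HasBicyclicBassFreePair (G : Type*) [Group G] : Prop :=
  ∃ v u : (MonoidAlgebra ℤ G)ˣ, IsBicyclicUnit v ∧ IsBassCyclicUnit u ∧
    ∃ t : ℕ, 0 < t ∧ IsFreePair (v ^ t) u

end

theorem isFreePair_of_injective_lift {Γ : Type*} [Group Γ] (u v : Γ)
    (h : Function.Injective (FreeGroup.lift ![u, v])) : IsFreePair u v := by
  have hr : (FreeGroup.lift ![u, v]).range = Subgroup.closure {u, v} := by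
    rw [FreeGroup.range_lift_eq_closure, Matrix.range_cons, Matrix.range_cons, Matrix.range_empty]
    simp [Set.pair_comm]
  have e : FreeGroup (Fin 2) ≃* Subgroup.closure ({u, v} : Set Γ) :=
    (MonoidHom.ofInjective h).trans (MulEquiv.subgroupCongr hr)
  refine ⟨IsFreeGroup.ofMulEquiv e, fun hc => ?_⟩
  have h01 : FreeGroup.of (0 : Fin 2) * FreeGroup.of 1 = FreeGroup.of 1 * FreeGroup.of 0 := by
    apply e.injective
    rw [map_mul, map_mul]
    exact hc.is_comm.comm _ _
  revert h01
  decide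

theorem IsFreePair.map {Γ Δ : Type*} [Group Γ] [Group Δ] {u v : Γ} (h : IsFreePair u v)
    (f : Γ →* Δ) (hf : Function.Injective f) : IsFreePair (f u) (f v) := by
  have hr : (Subgroup.closure ({u, v} : Set Γ)).map f = Subgroup.closure {f u, f v} := by
    rw [MonoidHom.map_closure, Set.image_pair]
  have e : Subgroup.closure ({u, v} : Set Γ) ≃* Subgroup.closure ({f u, f v} : Set Δ) :=
    ((Subgroup.closure ({u, v} : Set Γ)).equivMapOfInjective f hf).trans (MulEquiv.subgroupCongr hr)
  obtain ⟨h1, h2⟩ := h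
  refine ⟨IsFreeGroup.ofMulEquiv e, fun hc => h2 ⟨⟨fun a b => e.injective ?_⟩⟩⟩
  rw [map_mul, map_mul]
  exact hc.is_comm.comm _ _

theorem not_isFreePair_of_isOfFinOrder {Γ : Type*} [Group Γ] {u v : Γ} (hv : IsOfFinOrder v) :
    ¬ IsFreePair u v := by
  rintro ⟨h1, h2⟩
  have hv1 : v = 1 := by
    obtain ⟨n, hn, hvn⟩ := hv.exists_pow_eq_one
    have hm : v ∈ Subgroup.closure ({u, v} : Set Γ) := Subgroup.subset_closure (by simp)
    let e := IsFreeGroup.toFreeGroup (Subgroup.closure ({u, v} : Set Γ))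
    have : e ⟨v, hm⟩ ^ n = 1 := by
      rw [← map_pow, map_eq_one_iff e e.injective]
      exact Subtype.ext hvn
    rw [pow_eq_one_iff_left hn.ne', map_eq_one_iff e e.injective] at this
    exact congrArg Subtype.val this
  apply h2
  subst hv1
  rw [Set.pair_comm, Subgroup.closure_insert_one, ← Subgroup.zpowers_eq_closure]
  infer_instance

theorem injective_lift_of_semiconj {ι Γ Δ α β : Type*} [Group Γ] [Group Δ] [MulAction Δ α]
    [FaithfulSMul Δ α] [MulAction Γ β] (f : ι → Γ) (g : ι → Δ) (e : α → β)
    (he : Function.Injective e) (h : ∀ i a, f i • e a = e (g i • a))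
    (hg : Function.Injective (FreeGroup.lift g)) : Function.Injective (FreeGroup.lift f) := by
  have key : ∀ w a, FreeGroup.lift f w • e a = e (FreeGroup.lift g w • a) := by
    intro w
    induction w using FreeGroup.induction_on with
    | C1 => simp
    | of i => simpa using h i
    | inv_of i ih =>
      intro a
      rw [map_inv, map_inv, inv_smul_eq_iff, ih, smul_inv_smul]
    | mul x y hx hy =>
      intro a
      rw [map_mul, map_mul, mul_smul, mul_smul, hy, hx]
  rw [injective_iff_map_eq_one] at hg ⊢
  intro w hw
  apply hg
  refine FaithfulSMul.eq_of_smul_eq_smul (α := α) fun a => he ?_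
  rw [← key, hw, one_smul, one_smul]

/-- The punctured plane. -/
abbrev PuncturedPlane := {z : ℝ × ℝ // z ≠ 0}

theorem add_smul_sub_ne_zero (τ : ℝ) {z : ℝ × ℝ} (hz : z ≠ 0) :
    (z.1 + τ * (z.2 - z.1), z.2 + τ * (z.2 - z.1)) ≠ 0 := by
  obtain ⟨p, q⟩ := z
  contrapose! hz
  simp only [Prod.mk_eq_zero] at hz ⊢
  have hpq : q = p := by linear_combination hz.2 - hz.1
  subst hpq
  simpa using hz

/-- The perturbation `1 + τ E` of the identity of the punctured plane, where
`E (p, q) = (q - p) • (1, 1)`. -/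
noncomputable def shear (τ : ℝ) : Equiv.Perm PuncturedPlane where
  toFun z := ⟨_, add_smul_sub_ne_zero τ z.2⟩
  invFun z := ⟨_, add_smul_sub_ne_zero (-τ) z.2⟩
  left_inv z := by ext <;> dsimp only <;> ring
  right_inv z := by ext <;> dsimp only <;> ring

/-- The dilation `(p, q) ↦ (Λ p, q)` of the punctured plane. -/
noncomputable def dilation (Λ : ℝ) (hΛ : Λ ≠ 0) : Equiv.Perm PuncturedPlane where
  toFun z := ⟨(Λ * z.1.1, z.1.2), by
    obtain ⟨⟨p, q⟩, hz⟩ := z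
    simpa [hΛ] using hz⟩
  invFun z := ⟨(Λ⁻¹ * z.1.1, z.1.2), by
    obtain ⟨⟨p, q⟩, hz⟩ := z
    simpa [hΛ] using hz⟩
  left_inv z := by ext <;> simp [hΛ]
  right_inv z := by ext <;> simp [hΛ]

theorem injective_lift_shear_dilation {τ Λ : ℝ} (hτ : 4 ≤ τ) (hΛ : 16 ≤ Λ) (h0 : Λ ≠ 0) :
    Function.Injective (FreeGroup.lift ![shear τ, dilation Λ h0]) := by
  have hτ' : ∀ d : ℝ, 4 * d ^ 2 ≤ τ * d ^ 2 := fun d => by gcongr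
  have hΛ' : 256 ≤ Λ ^ 2 := by nlinarith
  have hΛi : Λ⁻¹ ^ 2 ≤ 1 / 256 := by
    rw [inv_pow, one_div]
    exact inv_anti₀ (by norm_num) hΛ'
  let X₀ : Set PuncturedPlane := {z | 2 * (z.1.2 - z.1.1) ^ 2 ≤ z.1.1 * (z.1.2 - z.1.1)}
  let X₁ : Set PuncturedPlane := {z | 16 * z.1.2 ^ 2 ≤ z.1.1 ^ 2}
  let Y₀ : Set PuncturedPlane := {z | z.1.1 * (z.1.2 - z.1.1) < -2 * (z.1.2 - z.1.1) ^ 2}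
  let Y₁ : Set PuncturedPlane := {z | 16 * z.1.1 ^ 2 < z.1.2 ^ 2}
  have mX₀ {z} : z ∈ X₀ ↔ 2 * (z.1.2 - z.1.1) ^ 2 ≤ z.1.1 * (z.1.2 - z.1.1) := Iff.rfl
  have mX₁ {z} : z ∈ X₁ ↔ 16 * z.1.2 ^ 2 ≤ z.1.1 ^ 2 := Iff.rfl
  have mY₀ {z} : z ∈ Y₀ ↔ z.1.1 * (z.1.2 - z.1.1) < -2 * (z.1.2 - z.1.1) ^ 2 := Iff.rfl
  have mY₁ {z} : z ∈ Y₁ ↔ 16 * z.1.1 ^ 2 < z.1.2 ^ 2 := Iff.rfl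
  have hpos : ∀ z : PuncturedPlane, 0 < z.1.1 ^ 2 + z.1.2 ^ 2 := by
    rintro ⟨⟨p, q⟩, hz⟩
    by_contra! hpq
    exact hz (Prod.ext (by dsimp at *; nlinarith) (by dsimp at *; nlinarith))
  have hX : Disjoint X₀ X₁ := Set.disjoint_left.2 fun z h1 h2 => by
    rw [mX₀] at h1; rw [mX₁] at h2
    nlinarith [hpos z]
  have hY : Disjoint Y₀ Y₁ := Set.disjoint_left.2 fun z h1 h2 => by
    rw [mY₀] at h1; rw [mY₁] at h2
    nlinarith
  have h00 : Disjoint X₀ Y₀ := Set.disjoint_left.2 fun z h1 h2 => by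
    rw [mX₀] at h1; rw [mY₀] at h2
    nlinarith
  have h01 : Disjoint X₀ Y₁ := Set.disjoint_left.2 fun z h1 h2 => by
    rw [mX₀] at h1; rw [mY₁] at h2
    nlinarith
  have h10 : Disjoint X₁ Y₀ := Set.disjoint_left.2 fun z h1 h2 => by
    rw [mX₁] at h1; rw [mY₀] at h2
    nlinarith
  have h11 : Disjoint X₁ Y₁ := Set.disjoint_left.2 fun z h1 h2 => by
    rw [mX₁] at h1; rw [mY₁] at h2
    nlinarith
  refine FreeGroup.injective_lift_of_ping_pong _ (X := ![X₀, X₁]) (Y := ![Y₀, Y₁])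
    (hXnonempty := ?_) (hXdisj := ?_) (hYdisj := ?_) (hXYdisj := ?_) (hX := ?_) (hY := ?_)
  · refine Fin.forall_fin_two.2 ⟨⟨⟨(1, 1), by simp⟩, ?_⟩, ⟨⟨(1, 0), by simp⟩, ?_⟩⟩
    · exact mX₀.2 (by norm_num)
    · exact mX₁.2 (by norm_num)
  · intro i j hij
    fin_cases i <;> fin_cases j <;> first | exact hX | exact hX.symm | exact absurd rfl hij
  · intro i j hij
    fin_cases i <;> fin_cases j <;> first | exact hY | exact hY.symm | exact absurd rfl hij
  · exact Fin.forall_fin_two.2 ⟨Fin.forall_fin_two.2 ⟨h00, h01⟩, Fin.forall_fin_two.2 ⟨h10, h11⟩⟩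
  · refine Fin.forall_fin_two.2 ⟨?_, ?_⟩
    · rintro _ ⟨⟨⟨p, q⟩, hpq⟩, hz, rfl⟩
      replace hz := not_lt.1 (mt mY₀.2 hz)
      refine mX₀.2 ?_
      dsimp [shear] at hz ⊢
      nlinarith [hτ' (q - p)]
    · rintro _ ⟨⟨⟨p, q⟩, hpq⟩, hz, rfl⟩
      replace hz := not_lt.1 (mt mY₁.2 hz)
      refine mX₁.2 ?_
      dsimp [dilation] at hz ⊢
      nlinarith [mul_le_mul_of_nonneg_right hΛ' (sq_nonneg p)]
  · refine Fin.forall_fin_two.2 ⟨?_, ?_⟩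
    · rintro _ ⟨⟨⟨p, q⟩, hpq⟩, hz, rfl⟩
      replace hz := not_le.1 (mt mX₀.2 hz)
      refine mY₀.2 ?_
      change (p + -τ * (q - p)) * ((q + -τ * (q - p)) - (p + -τ * (q - p))) <
        -2 * ((q + -τ * (q - p)) - (p + -τ * (q - p))) ^ 2
      dsimp at hz
      nlinarith [hτ' (q - p)]
    · rintro _ ⟨⟨⟨p, q⟩, hpq⟩, hz, rfl⟩
      replace hz := not_le.1 (mt mX₁.2 hz)
      refine mY₁.2 ?_
      change 16 * (Λ⁻¹ * p) ^ 2 < q ^ 2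
      dsimp at hz
      nlinarith [mul_le_mul_of_nonneg_right hΛi (sq_nonneg p)]

/-- The action of the even permutations of `Fin 5` on functions of two variables. -/
def pairRep : alternatingGroup (Fin 5) →* Module.End ℝ (Fin 5 → Fin 5 → ℝ) where
  toFun g :=
    { toFun := fun F i j => F ((g⁻¹ : Equiv.Perm (Fin 5)) i) ((g⁻¹ : Equiv.Perm (Fin 5)) j)
      map_add' := fun _ _ => rfl
      map_smul' := fun _ _ => rfl }
  map_one' := by ext; simp
  map_mul' g h := by ext; simp

theorem pairRep_apply_of_rightInverse {g : alternatingGroup (Fin 5)} {σ : Fin 5 → Fin 5}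
    (h : ∀ i, (g : Equiv.Perm (Fin 5)) (σ i) = i) (F : Fin 5 → Fin 5 → ℝ) :
    pairRep g F = fun i j => F (σ i) (σ j) := by
  have hg : ∀ i, (g⁻¹ : Equiv.Perm (Fin 5)) i = σ i := fun i => by
    rw [Equiv.Perm.inv_eq_iff_eq, h]
  ext i j
  exact congrArg₂ F (hg i) (hg j)

/-- `pairRep`, extended to the integral group ring. -/
noncomputable def ringRep :
    MonoidAlgebra ℤ (alternatingGroup (Fin 5)) →ₐ[ℤ] Module.End ℝ (Fin 5 → Fin 5 → ℝ) :=
  MonoidAlgebra.lift ℤ _ _ pairRep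

@[simp]
theorem ringRep_of (g : alternatingGroup (Fin 5)) :
    ringRep (MonoidAlgebra.of ℤ _ g) = pairRep g := MonoidAlgebra.lift_of ..

/-- A vector fixed by the five-cycle. -/
noncomputable def axisVec : Fin 5 → Fin 5 → ℝ :=
  ![![0, 1 - √5 / 5, 1 + 3 * √5 / 5, -1 - 3 * √5 / 5, √5 / 5 - 1],
    ![√5 / 5 - 1, 0, 1 - √5 / 5, 1 + 3 * √5 / 5, -1 - 3 * √5 / 5],
    ![-1 - 3 * √5 / 5, √5 / 5 - 1, 0, 1 - √5 / 5, 1 + 3 * √5 / 5],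
    ![1 + 3 * √5 / 5, -1 - 3 * √5 / 5, √5 / 5 - 1, 0, 1 - √5 / 5],
    ![1 - √5 / 5, 1 + 3 * √5 / 5, -1 - 3 * √5 / 5, √5 / 5 - 1, 0]]

/-- A vector spanning the image under `(1 - a) b (1 + a)` of the irreducible subrepresentation
that contains `axisVec`. -/
noncomputable def shearVec : Fin 5 → Fin 5 → ℝ :=
  ![![0, 6 + 2 * √5, -1 - √5, -3 - √5, -2],
    ![-6 - 2 * √5, 0, 3 + √5, 1 + √5, 2],
    ![1 + √5, -3 - √5, 0, -2 - 2 * √5, 4 + 2 * √5],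
    ![3 + √5, -1 - √5, 2 + 2 * √5, 0, -4 - 2 * √5],
    ![2, -2, -4 - 2 * √5, 4 + 2 * √5, 0]]

theorem sqrt_five_mul_self : √5 * √5 = 5 := Real.mul_self_sqrt (by norm_num)

section

variable {a b c : alternatingGroup (Fin 5)}

theorem pairRep_involution (ha : (a : Equiv.Perm (Fin 5)) = c[0, 1] * c[2, 3])
    (F : Fin 5 → Fin 5 → ℝ) :
    pairRep a F = fun i j => F (![1, 0, 3, 2, 4] i) (![1, 0, 3, 2, 4] j) :=
  pairRep_apply_of_rightInverse (by rw [ha]; decide) F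

theorem pairRep_threeCycle (hb : (b : Equiv.Perm (Fin 5)) = c[0, 2, 4])
    (F : Fin 5 → Fin 5 → ℝ) :
    pairRep b F = fun i j => F (![4, 1, 0, 3, 2] i) (![4, 1, 0, 3, 2] j) :=
  pairRep_apply_of_rightInverse (by rw [hb]; decide) F

theorem pairRep_fiveCycle (hc : (c : Equiv.Perm (Fin 5)) = c[0, 1, 2, 3, 4])
    (F : Fin 5 → Fin 5 → ℝ) :
    pairRep c F = fun i j => F (![4, 0, 1, 2, 3] i) (![4, 0, 1, 2, 3] j) :=
  pairRep_apply_of_rightInverse (by rw [hc]; decide) F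

theorem pairRep_axisVec (hc : (c : Equiv.Perm (Fin 5)) = c[0, 1, 2, 3, 4]) :
    pairRep c axisVec = axisVec := by
  rw [pairRep_fiveCycle hc]
  ext i j
  fin_cases i <;> fin_cases j <;> simp [axisVec]

theorem pairRep_sq_shearVec_sub_axisVec
    (hc : (c : Equiv.Perm (Fin 5)) = c[0, 1, 2, 3, 4]) :
    pairRep c (pairRep c (shearVec - axisVec)) =
      ((√5 - 1) / 2) • pairRep c (shearVec - axisVec) - (shearVec - axisVec) := by
  have h5 := sqrt_five_mul_self
  simp only [pairRep_fiveCycle hc]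
  ext i j
  simp only [Pi.sub_apply, Pi.smul_apply, smul_eq_mul]
  fin_cases i <;> fin_cases j <;> simp [axisVec, shearVec] <;> linarith

theorem bicyclic_axisVec (ha : (a : Equiv.Perm (Fin 5)) = c[0, 1] * c[2, 3])
    (hb : (b : Equiv.Perm (Fin 5)) = c[0, 2, 4]) :
    ((1 - pairRep a) * pairRep b * (1 + pairRep a)) axisVec = (1 - √5 / 5) • shearVec := by
  have h5 := sqrt_five_mul_self
  simp only [Module.End.mul_apply, LinearMap.add_apply, LinearMap.sub_apply, Module.End.one_apply,
    pairRep_involution ha, pairRep_threeCycle hb]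
  ext i j
  simp only [Pi.sub_apply, Pi.add_apply, Pi.smul_apply, smul_eq_mul]
  fin_cases i <;> fin_cases j <;> simp [axisVec, shearVec] <;> linarith

end

theorem exists_add_zsmul_pow_eq {R : Type*} [Ring R] {y N : R} {d δ : ℤ} (q : ℤ)
    (hyN : y * N = δ • N) (hNy : N * y = δ • N) (hN : N * N = d • N) (m : ℕ) :
    ∃ e : ℤ, (y + q • N) ^ m = y ^ m + e • N ∧ (δ + q * d) ^ m = δ ^ m + e * d := by
  have hy : ∀ m : ℕ, y ^ m * N = δ ^ m • N := by
    intro m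
    induction m with
    | zero => simp
    | succ m ih => rw [pow_succ, mul_assoc, hyN, mul_smul_comm, ih, smul_smul, pow_succ']
  induction m with
  | zero => exact ⟨0, by simp, by simp⟩
  | succ m ih =>
    obtain ⟨e, h1, h2⟩ := ih
    refine ⟨q * δ ^ m + e * δ + e * q * d, ?_, by rw [pow_succ, h2]; ring⟩
    rw [pow_succ, h1, add_mul, mul_add, mul_add, mul_smul_comm, hy, smul_mul_assoc, hNy,
      smul_mul_assoc, mul_smul_comm, hN, pow_succ]
    module

section PowerSum

variable {G : Type*} [Group G]

theorem powerSum_succ (g : G) (k : ℕ) :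
    powerSum g (k + 1) = powerSum g k + MonoidAlgebra.of ℤ G (g ^ k) := Finset.sum_range_succ ..

theorem powerSum_add (g : G) (m n : ℕ) :
    powerSum g (m + n) = powerSum g m + MonoidAlgebra.of ℤ G (g ^ m) * powerSum g n := by
  simp only [powerSum, Finset.sum_range_add, Finset.mul_sum, pow_add, map_mul]

theorem of_pow_mul_powerSum {g : G} {d : ℕ} (h : g ^ d = 1) (j : ℕ) :
    MonoidAlgebra.of ℤ G (g ^ j) * powerSum g d = powerSum g d := by
  have h1 := powerSum_add g j d
  rw [add_comm j d, powerSum_add, h, map_one, one_mul, add_comm] at h1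
  exact (add_left_cancel h1).symm

theorem of_pow_mul_powerSum_comm (g : G) (j d : ℕ) :
    MonoidAlgebra.of ℤ G (g ^ j) * powerSum g d = powerSum g d * MonoidAlgebra.of ℤ G (g ^ j) := by
  simp only [powerSum, Finset.mul_sum, Finset.sum_mul, ← map_mul, ← pow_add, add_comm]

theorem powerSum_mul_powerSum {g : G} {d : ℕ} (h : g ^ d = 1) (j : ℕ) :
    powerSum g j * powerSum g d = (j : ℤ) • powerSum g d := by
  rw [powerSum, Finset.sum_mul, Finset.sum_congr rfl fun i _ => of_pow_mul_powerSum h i]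
  simp

theorem powerSum_mul_powerSum_comm (g : G) (j d : ℕ) :
    powerSum g j * powerSum g d = powerSum g d * powerSum g j := by
  rw [powerSum, Finset.sum_mul, Finset.mul_sum]
  exact Finset.sum_congr rfl fun i _ => of_pow_mul_powerSum_comm g i d

theorem powerSum_mul_self {g : G} {d : ℕ} (h : g ^ d = 1) (q : ℕ) :
    powerSum g (q * d) = (q : ℤ) • powerSum g d := by
  induction q with
  | zero => simp [powerSum]
  | succ q ih =>
    rw [add_mul, one_mul, powerSum_add, ih, of_pow_mul_powerSum h]
    push_cast
    module

theorem bassCyclic_eq_of_pow {x : G} {k q : ℕ} {δ : ℤ} {y : MonoidAlgebra ℤ G}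
    (hx : IsOfFinOrder x) (hyN : y * powerSum x (orderOf x) = δ • powerSum x (orderOf x))
    (hNy : powerSum x (orderOf x) * y = δ • powerSum x (orderOf x))
    (hk : powerSum x k = y + (q : ℤ) • powerSum x (orderOf x)) (hkδ : (k : ℤ) = δ + q * orderOf x)
    (m : ℕ) (hδ : δ ^ m = 1) : bassCyclic k m x = y ^ m := by
  obtain ⟨e, h1, h2⟩ := exists_add_zsmul_pow_eq (q : ℤ) hyN hNy
    (powerSum_mul_powerSum (pow_orderOf_eq_one x) (orderOf x)) m
  have hd : (orderOf x : ℤ) ≠ 0 := by exact_mod_cast hx.orderOf_pos.ne'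
  rw [bassCyclic, hk, h1, hkδ, h2, hδ, sub_add_cancel_left, ← neg_mul, Int.mul_ediv_cancel _ hd]
  module

/-- A Bass cyclic unit of an element of order `1`, `2`, `3` or `4` is a group element. -/
theorem exists_bassCyclic_eq_of {x : G} {k m : ℕ} (hx : IsOfFinOrder x)
    (h : orderOf x ∣ 3 ∨ orderOf x ∣ 4) (hk : Nat.Coprime k (orderOf x)) (hk0 : 0 < k)
    (hm : Nat.totient (orderOf x) ∣ m) :
    ∃ j : ℕ, bassCyclic k m x = MonoidAlgebra.of ℤ G (x ^ j) := by
  have key : (∃ q, k = q * orderOf x + 1) ∨ Even m ∧ ∃ q, k + 1 = q * orderOf x := by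
    have h4 : orderOf x ∈ ({1, 2, 3, 4} : Finset ℕ) := by
      have h3 : Nat.divisors 3 = {1, 3} := by decide
      have h4 : Nat.divisors 4 = {1, 2, 4} := by decide
      rcases h with h | h
      · have : orderOf x ∈ Nat.divisors 3 := by simp [h]
        rw [h3] at this; revert this; simp; tauto
      · have : orderOf x ∈ Nat.divisors 4 := by simp [h]
        rw [h4] at this; revert this; simp; tauto
    generalize orderOf x = d at *
    simp only [Finset.mem_insert, Finset.mem_singleton] at h4
    rcases h4 with rfl | rfl | rfl | rfl
    · exact .inl ⟨k - 1, by omega⟩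
    · have : k % 2 = 1 := by
        rcases Nat.mod_two_eq_zero_or_one k with h0 | h0
        · exact absurd hk ((Nat.not_coprime_of_dvd_of_dvd (by norm_num : 1 < 2)
            (Nat.dvd_of_mod_eq_zero h0) (dvd_refl 2)))
        · exact h0
      exact .inl ⟨k / 2, by omega⟩
    · have h0 : k % 3 ≠ 0 := fun h0 => absurd hk ((Nat.not_coprime_of_dvd_of_dvd
        (by norm_num : 1 < 3) (Nat.dvd_of_mod_eq_zero h0) (dvd_refl 3)))
      have hm' : Even m := even_iff_two_dvd.2 (by simpa [show Nat.totient 3 = 2 by decide] using hm)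
      rcases (by omega : k % 3 = 1 ∨ k % 3 = 2) with h1 | h1
      · exact .inl ⟨k / 3, by omega⟩
      · exact .inr ⟨hm', (k + 1) / 3, by omega⟩
    · have h0 : k % 2 ≠ 0 := fun h0 => absurd hk ((Nat.not_coprime_of_dvd_of_dvd
        (by norm_num : 1 < 2) (Nat.dvd_of_mod_eq_zero h0) (by norm_num : 2 ∣ 4)))
      have hm' : Even m := even_iff_two_dvd.2 (by simpa [show Nat.totient 4 = 2 by decide] using hm)
      rcases (by omega : k % 4 = 1 ∨ k % 4 = 3) with h1 | h1
      · exact .inl ⟨k / 4, by omega⟩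
      · exact .inr ⟨hm', (k + 1) / 4, by omega⟩
  rcases key with ⟨q, hq⟩ | ⟨hm, q, hq⟩
  · refine ⟨0, ?_⟩
    rw [bassCyclic_eq_of_pow (q := q) (δ := 1) (y := 1) hx (by simp) (by simp) ?_ ?_ m (by simp)]
    · rw [one_pow, pow_zero, map_one]
    · rw [hq, powerSum_succ, powerSum_mul_self (pow_orderOf_eq_one x), mul_comm, pow_mul,
        pow_orderOf_eq_one, one_pow, map_one, add_comm]
    · rw [hq]; push_cast; ring
  · refine ⟨k * m, ?_⟩
    have h1 := of_pow_mul_powerSum (pow_orderOf_eq_one x) k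
    rw [bassCyclic_eq_of_pow (q := q) (δ := -1) (y := -MonoidAlgebra.of ℤ G (x ^ k)) hx
      (by rw [neg_mul, h1, neg_one_smul])
      (by rw [mul_neg, ← of_pow_mul_powerSum_comm, h1, neg_one_smul]) ?_ ?_ m (by simp [hm])]
    · rw [hm.neg_pow, ← map_pow, pow_mul]
    · rw [← powerSum_mul_self (pow_orderOf_eq_one x), ← hq, powerSum_succ]
      abel
    · have : ((k + 1 : ℕ) : ℤ) = ((q * orderOf x : ℕ) : ℤ) := by rw [hq]
      push_cast at this
      linarith

theorem not_hasBicyclicBassFreePair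
    (h : ∀ x : G, orderOf x ∣ 3 ∨ orderOf x ∣ 4) : ¬ HasBicyclicBassFreePair G := by
  rintro ⟨v, u, -, ⟨x, k, m, hx, hk0, -, hk, hm, hu⟩, t, -, hf⟩
  refine not_isFreePair_of_isOfFinOrder ?_ hf
  obtain ⟨j, hj⟩ := exists_bassCyclic_eq_of hx (h x) hk hk0 hm
  obtain ⟨n, hn, hxn⟩ := (hx.pow (n := j)).exists_pow_eq_one
  refine isOfFinOrder_iff_pow_eq_one.2 ⟨n, hn, Units.ext ?_⟩
  rw [Units.val_pow_eq_pow_val, hu, hj, ← map_pow, hxn, map_one, Units.val_one]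

end PowerSum

section Map

variable {G H : Type*} [Group G] [Group H] (f : G →* H)

theorem map_powerSum (g : G) (k : ℕ) :
    MonoidAlgebra.mapDomainRingHom ℤ f (powerSum g k) = powerSum (f g) k := by
  simp [powerSum]

theorem HasBicyclicBassFreePair.map (hf : Function.Injective f)
    (h : HasBicyclicBassFreePair G) : HasBicyclicBassFreePair H := by
  obtain ⟨v, u, ⟨y, z, hz, hv⟩, ⟨x, k, m, hx, hk0, hm0, hk, hm, hu⟩, t, ht, huv⟩ := h
  let F := MonoidAlgebra.mapDomainRingHom ℤ f
  have hF : Function.Injective F := MonoidAlgebra.mapDomain_injective hf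
  have hof : ∀ g, F (MonoidAlgebra.of ℤ G g) = MonoidAlgebra.of ℤ H (f g) := fun g => by simp [F]
  have hps : ∀ g j, F (powerSum g j) = powerSum (f g) j := map_powerSum f
  have ho : ∀ g, orderOf (f g) = orderOf g := orderOf_injective f hf
  refine ⟨Units.map F v, Units.map F u, ⟨f y, f z, f.isOfFinOrder hz, ?_⟩,
    ⟨f x, k, m, f.isOfFinOrder hx, hk0, hm0, by rwa [ho], by rwa [ho], ?_⟩, t, ht, ?_⟩
  · refine hv.imp (fun hv => ?_) fun hv => ?_
    · rw [Units.coe_map, hv]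
      simp [bicyclicBeta, hof, hps, ho, -MonoidAlgebra.of_apply]
    · rw [Units.coe_map, hv]
      simp [bicyclicGamma, hof, hps, ho, -MonoidAlgebra.of_apply]
  · rw [Units.coe_map, hu]
    simp [bassCyclic, hps, ho]
  · rw [← map_pow]
    exact huv.map _ (Units.map_injective hF)

end Map

theorem orderOf_dvd_of_perm_fin {n : ℕ} (hn : n < 5) (σ : Equiv.Perm (Fin n)) :
    orderOf σ ∣ 3 ∨ orderOf σ ∣ 4 := by
  simp only [orderOf_dvd_iff_pow_eq_one]
  interval_cases n <;> revert σ <;> decide +kernel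

/-- The embedding of alternating groups induced by an embedding of the sets permuted. -/
noncomputable def alternatingGroupEmbedding {m n : ℕ} (h : m ≤ n) :
    alternatingGroup (Fin m) →* alternatingGroup (Fin n) :=
  ((Equiv.Perm.viaEmbeddingHom (Fin.castLEEmb h)).comp
    (alternatingGroup (Fin m)).subtype).codRestrict _ fun σ => by
      classical
      rw [Equiv.Perm.mem_alternatingGroup]
      simp only [MonoidHom.comp_apply, Subgroup.subtype_apply, Equiv.Perm.viaEmbeddingHom_apply,
        Equiv.Perm.viaEmbedding]
      rw [Equiv.Perm.sign_extendDomain]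
      exact σ.2

theorem alternatingGroupEmbedding_injective {m n : ℕ} (h : m ≤ n) :
    Function.Injective (alternatingGroupEmbedding h) := by
  intro σ τ hστ
  exact Subtype.ext (Equiv.Perm.viaEmbeddingHom_injective _ (congrArg Subtype.val hστ))

theorem mul_mul_mul_self_eq_zero {R : Type*} [Ring R] {p q n : R} (h : n * p = 0) :
    p * q * n * (p * q * n) = 0 := by
  have : p * q * n * (p * q * n) = p * q * (n * p) * (q * n) := by simp only [mul_assoc]
  rw [this, h, mul_zero, zero_mul]

/-- The unipotent unit `1 + e` given by an element `e` of square zero. -/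
def unitOfMulSelfEqZero {R : Type*} [Ring R] (e : R) (h : e * e = 0) : Rˣ where
  val := 1 + e
  inv := 1 - e
  val_inv := by
    have : (1 + e) * (1 - e) = 1 - e * e := by noncomm_ring
    rw [this, h, sub_zero]
  inv_val := by
    have : (1 - e) * (1 + e) = 1 - e * e := by noncomm_ring
    rw [this, h, sub_zero]

theorem powerSum_orderOf_mul_one_sub {G : Type*} [Group G] (h : G) :
    powerSum h (orderOf h) * (1 - MonoidAlgebra.of ℤ G h) = 0 := by
  have h1 := of_pow_mul_powerSum (pow_orderOf_eq_one h) 1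
  rw [of_pow_mul_powerSum_comm, pow_one] at h1
  rw [mul_sub, mul_one, h1, sub_self]

/-- The bicyclic unit `β_{x,h}`. -/
noncomputable def bicyclicBetaUnit {G : Type*} [Group G] (x h : G) : (MonoidAlgebra ℤ G)ˣ :=
  unitOfMulSelfEqZero _
    (mul_mul_mul_self_eq_zero (q := MonoidAlgebra.of ℤ G x) (powerSum_orderOf_mul_one_sub h))

section FiveCycle

variable {R : Type*} [Ring R] {x : R}

open Polynomial in
theorem bass_mul_inv_of_pow_five (hx : x ^ 5 = 1) :
    ((1 + x) ^ 4 - 3 * (1 + x + x ^ 2 + x ^ 3 + x ^ 4)) *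
      (1 + x - 2 * x ^ 2 + 3 * x ^ 3 - 2 * x ^ 4) = 1 := by
  have h : (((1 + X) ^ 4 - 3 * (1 + X + X ^ 2 + X ^ 3 + X ^ 4)) *
      (1 + X - 2 * X ^ 2 + 3 * X ^ 3 - 2 * X ^ 4) : ℤ[X]) =
      1 + (3 + X - 8 * X ^ 2 + 4 * X ^ 3) * (X ^ 5 - 1) := by ring
  have h' := congrArg (aeval x) h
  simpa only [map_mul, map_sub, map_add, map_pow, map_one, map_ofNat, aeval_X, hx, sub_self,
    mul_zero, add_zero] using h'

theorem commute_bass_inv :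
    Commute ((1 + x) ^ 4 - 3 * (1 + x + x ^ 2 + x ^ 3 + x ^ 4))
      (1 + x - 2 * x ^ 2 + 3 * x ^ 3 - 2 * x ^ 4) := by
  have hx (j : ℕ) : Commute x (x ^ j) := Commute.self_pow x j
  have : Commute x (1 + x - 2 * x ^ 2 + 3 * x ^ 3 - 2 * x ^ 4) :=
    ((((Commute.one_right x).add_right (Commute.refl x)).sub_right
      ((Commute.ofNat_right x 2).mul_right (hx 2))).add_right
      ((Commute.ofNat_right x 3).mul_right (hx 3))).sub_right
      ((Commute.ofNat_right x 2).mul_right (hx 4))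
  have h1 := (Commute.one_left (1 + x - 2 * x ^ 2 + 3 * x ^ 3 - 2 * x ^ 4))
  exact ((h1.add_left this).pow_left 4).sub_left ((Commute.ofNat_left 3 _).mul_left
    ((((h1.add_left this).add_left (this.pow_left 2)).add_left (this.pow_left 3)).add_left
      (this.pow_left 4)))

end FiveCycle

theorem bassCyclic_two_four {G : Type*} [Group G] {x : G} (hx : orderOf x = 5) :
    bassCyclic 2 4 x = (1 + MonoidAlgebra.of ℤ G x) ^ 4 - 3 * (1 + MonoidAlgebra.of ℤ G x +
      MonoidAlgebra.of ℤ G x ^ 2 + MonoidAlgebra.of ℤ G x ^ 3 + MonoidAlgebra.of ℤ G x ^ 4) := by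
  have h : (1 - 2 ^ 4 : ℤ) / 5 = -3 := by norm_num
  simp only [bassCyclic, hx, powerSum, Finset.sum_range_succ, Finset.sum_range_zero, map_pow,
    pow_zero, pow_one, zero_add, Nat.cast_ofNat, h]
  rw [neg_smul, ← sub_eq_add_neg, zsmul_eq_mul]
  norm_num

/-- The Bass cyclic unit `u_{2,4}(x)` of an element `x` of order `5`. -/
noncomputable def bassUnit {G : Type*} [Group G] {x : G} (hx : orderOf x = 5) :
    (MonoidAlgebra ℤ G)ˣ :=
  have h5 : MonoidAlgebra.of ℤ G x ^ 5 = 1 := by rw [← map_pow, ← hx, pow_orderOf_eq_one, map_one]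
  { val := bassCyclic 2 4 x
    inv := 1 + MonoidAlgebra.of ℤ G x - 2 * MonoidAlgebra.of ℤ G x ^ 2 +
      3 * MonoidAlgebra.of ℤ G x ^ 3 - 2 * MonoidAlgebra.of ℤ G x ^ 4
    val_inv := by rw [bassCyclic_two_four hx, bass_mul_inv_of_pow_five h5]
    inv_val := by
      rw [bassCyclic_two_four hx, ← commute_bass_inv.eq, bass_mul_inv_of_pow_five h5] }

theorem bassCyclic_two_four_pow {G : Type*} [Group G] {x : G} (hx : orderOf x = 5) (s : ℕ) :
    bassCyclic 2 4 x ^ s = bassCyclic 2 (4 * s) x := by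
  have hx1 : x ^ 5 = 1 := by rw [← hx, pow_orderOf_eq_one]
  have h2 (m : ℕ) : powerSum x 2 ^ m * powerSum x 5 = (2 ^ m : ℤ) • powerSum x 5 := by
    induction m with
    | zero => simp
    | succ m ih =>
      rw [pow_succ, mul_assoc, powerSum_mul_powerSum hx1, mul_smul_comm, ih, smul_smul, pow_succ']
      rfl
  have hc : Commute (powerSum x 2) (powerSum x 5) := powerSum_mul_powerSum_comm x 2 5
  obtain ⟨e, h3, h4⟩ := exists_add_zsmul_pow_eq (-3) (h2 4)
    ((hc.pow_left 4).eq ▸ h2 4) (powerSum_mul_powerSum hx1 5) s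
  have h5 : (1 - 2 ^ 4 : ℤ) / 5 = -3 := by norm_num
  have h6 : (1 - 2 ^ (4 * s) : ℤ) / 5 = e := by
    norm_num at h4
    rw [pow_mul]
    norm_num
    omega
  simp only [bassCyclic, hx, Nat.cast_ofNat, h5, h6]
  rw [h3, pow_mul]

section Eigen

variable {M : Type*} [AddCommGroup M] [Module ℝ M] {C : Module.End ℝ M} {w : M} {ψ : ℝ}

/-- The element `u_{2,4}` of a five-cycle acts on a vector annihilated by `C² - ψ C + 1` as
`(ψ + 2)² C²`. -/
theorem bass_apply_of_quadratic (hψ : ψ ^ 2 + ψ = 1) (hw : C (C w) = ψ • C w - w) :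
    ((1 + C) ^ 4 - 3 * (1 + C + C ^ 2 + C ^ 3 + C ^ 4) : Module.End ℝ M) w = (ψ + 2) ^ 2 • (C ^ 2) w := by
  have e4 : ((1 + C) ^ 4 - 3 * (1 + C + C ^ 2 + C ^ 3 + C ^ 4)) =
      C + C ^ 2 + C ^ 2 + C ^ 2 + C ^ 3 - C ^ 4 - C ^ 4 - 1 - 1 := by
    noncomm_ring
  have h2 : (C ^ 2) w = ψ • C w - w := by rw [pow_two, Module.End.mul_apply, hw]
  have h3 : (C ^ 3) w = ψ • (ψ • C w - w) - C w := by
    rw [pow_succ', Module.End.mul_apply, h2, map_sub, map_smul, hw]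
  have h4 : (C ^ 4) w = ψ • (ψ • (ψ • C w - w) - C w) - (ψ • C w - w) := by
    rw [pow_succ', Module.End.mul_apply, h3, map_sub, map_smul, map_sub, map_smul, hw]
  rw [e4]
  simp only [LinearMap.add_apply, LinearMap.sub_apply, Module.End.one_apply]
  rw [h2, h3, h4]
  have h1 : ψ ^ 2 = 1 - ψ := by linarith
  have h1' : ψ ^ 3 = 2 * ψ - 1 := by linear_combination (ψ - 1) * hψ
  match_scalars <;> ring_nf <;> simp only [h1, h1'] <;> ring

theorem bass_pow_five_apply_of_quadratic (hψ : ψ ^ 2 + ψ = 1) (hw : C (C w) = ψ • C w - w)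
    (hC : C ^ 5 = 1) :
    (((1 + C) ^ 4 - 3 * (1 + C + C ^ 2 + C ^ 3 + C ^ 4)) ^ 5 : Module.End ℝ M) w = ((ψ + 2) ^ 2) ^ 5 • w := by
  have hU := bass_apply_of_quadratic hψ hw
  have hcomm : Commute C ((1 + C) ^ 4 - 3 * (1 + C + C ^ 2 + C ^ 3 + C ^ 4)) := by
    have hx (j : ℕ) : Commute C (C ^ j) := Commute.self_pow C j
    have h1 := (Commute.one_right C).add_right (Commute.refl C)
    exact (h1.pow_right 4).sub_right ((Commute.ofNat_right C 3).mul_right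
      (((h1.add_right (hx 2)).add_right (hx 3)).add_right (hx 4)))
  generalize (1 + C) ^ 4 - 3 * (1 + C + C ^ 2 + C ^ 3 + C ^ 4) = U at hU hcomm
  have key : ∀ n : ℕ, (U ^ n) w = ((ψ + 2) ^ 2) ^ n • (C ^ (2 * n)) w := by
    intro n
    induction n with
    | zero => simp
    | succ n ih =>
      rw [pow_succ', Module.End.mul_apply, ih, map_smul, ← Module.End.mul_apply,
        ← (hcomm.pow_left _).eq, Module.End.mul_apply, hU, map_smul, ← Module.End.mul_apply,
        ← pow_add, smul_smul, ← pow_succ, Nat.mul_succ]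
  rw [key, show 2 * 5 = 5 * 2 from rfl, pow_mul, hC, one_pow, Module.End.one_apply]

theorem bass_apply_of_fixed (hw : C w = w) :
    ((1 + C) ^ 4 - 3 * (1 + C + C ^ 2 + C ^ 3 + C ^ 4) : Module.End ℝ M) w = w := by
  have e4 : ((1 + C) ^ 4 - 3 * (1 + C + C ^ 2 + C ^ 3 + C ^ 4)) =
      C + C ^ 2 + C ^ 2 + C ^ 2 + C ^ 3 - C ^ 4 - C ^ 4 - 1 - 1 := by
    noncomm_ring
  rw [e4]
  simp only [LinearMap.add_apply, LinearMap.sub_apply, Module.End.one_apply, pow_succ, pow_zero,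
    one_mul, Module.End.mul_apply, hw]
  abel

end Eigen

section Main

variable {a b c : alternatingGroup (Fin 5)}

/-- The plane spanned by `shearVec - axisVec` and `axisVec`. -/
noncomputable def planeEmb (z : PuncturedPlane) : Fin 5 → Fin 5 → ℝ :=
  z.1.1 • (shearVec - axisVec) + z.1.2 • axisVec

theorem planeEmb_injective : Function.Injective planeEmb := by
  rintro ⟨⟨p, q⟩, h⟩ ⟨⟨p', q'⟩, h'⟩ he
  have h5 := sqrt_five_mul_self
  have h0 := Real.sqrt_nonneg (5 : ℝ)
  have e1 := congrFun (congrFun he 0) 1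
  have e2 := congrFun (congrFun he 1) 2
  simp [planeEmb, axisVec, shearVec] at e1 e2
  have hp : (3 + √5) * (p - p') = 0 := by linarith
  have hp' : p = p' := by
    rcases mul_eq_zero.1 hp with h | h
    · linarith
    · linarith
  subst hp'
  have hq : (1 - √5 / 5) * (q - q') = 0 := by linarith
  have hq' : q = q' := by
    rcases mul_eq_zero.1 hq with h | h
    · have : √5 = 5 := by linarith
      rw [this] at h5
      norm_num at h5
    · linarith
  subst hq'
  rfl

theorem ringRep_bicyclicBeta_pow_planeEmb
    (ha : (a : Equiv.Perm (Fin 5)) = c[0, 1] * c[2, 3])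
    (hb : (b : Equiv.Perm (Fin 5)) = c[0, 2, 4]) (t : ℕ) (z : PuncturedPlane) :
    ringRep (bicyclicBeta b a ^ t) (planeEmb z) = planeEmb (shear (t * (1 - √5 / 5)) z) := by
  have ho : orderOf a = 2 := orderOf_eq_prime (Subtype.ext (by
      rw [Subgroup.coe_pow, ha]; decide)) fun h => by
    rw [h] at ha; revert ha; decide
  have hE := bicyclic_axisVec ha hb
  have hβ : ringRep (bicyclicBeta b a) = 1 + (1 - pairRep a) * pairRep b * (1 + pairRep a) := by
    simp only [bicyclicBeta, ho, powerSum, Finset.sum_range_succ, Finset.sum_range_zero, zero_add,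
      pow_zero, pow_one, map_add, map_mul, map_sub, map_one, ringRep_of]
  have ha2 : pairRep a * pairRep a = 1 := by
    rw [← map_mul, ← pow_two, ← ho, pow_orderOf_eq_one, map_one]
  have hE2 : ((1 - pairRep a) * pairRep b * (1 + pairRep a)) *
      ((1 - pairRep a) * pairRep b * (1 + pairRep a)) = 0 := by
    have : (1 + pairRep a) * (1 - pairRep a) = 0 := by
      rw [add_mul, mul_sub, mul_sub, ha2]; simp
    exact mul_mul_mul_self_eq_zero this
  generalize (1 - pairRep a) * pairRep b * (1 + pairRep a) = E at hE hβ hE2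
  have hl : (1 - √5 / 5) ≠ 0 := fun h => by
    have h5 := sqrt_five_mul_self
    rw [show √5 = 5 by linarith] at h5
    norm_num at h5
  have hEs : E shearVec = 0 := by
    have h1 := congrArg E hE
    rw [← Module.End.mul_apply, hE2, map_smul] at h1
    exact (smul_eq_zero.1 h1.symm).resolve_left hl
  have hpow : ∀ t : ℕ, (1 + E) ^ t = 1 + (t : ℝ) • E := by
    intro t
    induction t with
    | zero => simp
    | succ t ih =>
      rw [pow_succ, ih, mul_add, mul_one, add_mul, one_mul, smul_mul_assoc, hE2, smul_zero]
      push_cast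
      module
  rw [map_pow, hβ, hpow]
  simp only [planeEmb, LinearMap.add_apply, LinearMap.smul_apply, Module.End.one_apply, map_add,
    map_smul, map_sub, hE, hEs, shear, Equiv.coe_fn_mk]
  module

theorem orderOf_fiveCycle (hc : (c : Equiv.Perm (Fin 5)) = c[0, 1, 2, 3, 4]) : orderOf c = 5 :=
  haveI : Fact (Nat.Prime 5) := ⟨by norm_num⟩
  orderOf_eq_prime (Subtype.ext (by rw [Subgroup.coe_pow, hc]; decide)) fun h => by
    rw [h] at hc; revert hc; decide

theorem ringRep_bassCyclic_pow_planeEmb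
    (hc : (c : Equiv.Perm (Fin 5)) = c[0, 1, 2, 3, 4]) (hΛ) (z : PuncturedPlane) :
    ringRep (bassCyclic 2 4 c ^ 5) (planeEmb z) =
      planeEmb (dilation ((((√5 - 1) / 2 + 2) ^ 2) ^ 5) hΛ z) := by
  have ho := orderOf_fiveCycle hc
  have h5 := sqrt_five_mul_self
  have hc5 : c ^ 5 = 1 := orderOf_dvd_iff_pow_eq_one.1 ho.dvd
  have hC : pairRep c ^ 5 = 1 := by rw [← map_pow, hc5, map_one]
  have h1 := bass_pow_five_apply_of_quadratic (ψ := (√5 - 1) / 2) (by linarith)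
    (pairRep_sq_shearVec_sub_axisVec hc) hC
  have hu : ringRep (bassCyclic 2 4 c) = (1 + pairRep c) ^ 4 -
      3 * (1 + pairRep c + pairRep c ^ 2 + pairRep c ^ 3 + pairRep c ^ 4) := by
    rw [bassCyclic_two_four ho]
    simp only [map_sub, map_add, map_mul, map_pow, map_one, map_ofNat, ringRep_of]
  have hax : pairRep c axisVec = axisVec := pairRep_axisVec hc
  have hax2 : ringRep (bassCyclic 2 4 c) axisVec = axisVec := by
    rw [hu]
    exact bass_apply_of_fixed hax
  have h2 : ringRep (bassCyclic 2 4 c ^ 5) (shearVec - axisVec) =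
      (((√5 - 1) / 2 + 2) ^ 2) ^ 5 • (shearVec - axisVec) := by
    have hp : ringRep (bassCyclic 2 4 c ^ 5) = ringRep (bassCyclic 2 4 c) ^ 5 := map_pow _ _ _
    rw [hp, hu]
    convert h1 using 2
  have hax5 : ringRep (bassCyclic 2 4 c ^ 5) axisVec = axisVec := by
    have hp : ringRep (bassCyclic 2 4 c ^ 5) = ringRep (bassCyclic 2 4 c) ^ 5 := map_pow _ _ _
    rw [hp]
    simp only [pow_succ, pow_zero, one_mul, Module.End.mul_apply, hax2]
  rw [planeEmb, map_add, map_smul, map_smul, h2, hax5, smul_smul, planeEmb, mul_comm]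
  rfl

theorem isFreePair_bicyclicBeta_bassCyclic
    {u v : (MonoidAlgebra ℤ (alternatingGroup (Fin 5)))ˣ}
    (ha : (a : Equiv.Perm (Fin 5)) = c[0, 1] * c[2, 3])
    (hb : (b : Equiv.Perm (Fin 5)) = c[0, 2, 4])
    (hc : (c : Equiv.Perm (Fin 5)) = c[0, 1, 2, 3, 4])
    (hu : (u : MonoidAlgebra ℤ (alternatingGroup (Fin 5))) = bassCyclic 2 4 c)
    (hv : (v : MonoidAlgebra ℤ (alternatingGroup (Fin 5))) = bicyclicBeta b a) :
    IsFreePair (v ^ 8) (u ^ 5) := by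
  have h5 := sqrt_five_mul_self
  have h0 := Real.sqrt_nonneg (5 : ℝ)
  have hτ : 4 ≤ ((8 : ℕ) : ℝ) * (1 - √5 / 5) := by push_cast; nlinarith
  have h2 : 1 ≤ √5 := by nlinarith
  have hΛ : 16 ≤ (((√5 - 1) / 2 + 2) ^ 2) ^ 5 := by
    have h4 : (4 : ℝ) ≤ ((√5 - 1) / 2 + 2) ^ 2 := by nlinarith
    calc (16 : ℝ) ≤ 4 ^ 5 := by norm_num
      _ ≤ _ := by gcongr
  have hΛ0 : (((√5 - 1) / 2 + 2) ^ 2) ^ 5 ≠ 0 := by positivity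
  let Φ : (MonoidAlgebra ℤ (alternatingGroup (Fin 5)))ˣ →* (Module.End ℝ (Fin 5 → Fin 5 → ℝ))ˣ :=
    Units.map (ringRep : _ →* Module.End ℝ (Fin 5 → Fin 5 → ℝ))
  have hΦ (w : (MonoidAlgebra ℤ (alternatingGroup (Fin 5)))ˣ) (F : Fin 5 → Fin 5 → ℝ) :
      Φ w • F = ringRep (w : MonoidAlgebra ℤ (alternatingGroup (Fin 5))) F := rfl
  have hV (z : PuncturedPlane) : Φ (v ^ 8) • planeEmb z =
      planeEmb (shear (((8 : ℕ) : ℝ) * (1 - √5 / 5)) • z) := by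
    rw [hΦ, Units.val_pow_eq_pow_val, hv, ringRep_bicyclicBeta_pow_planeEmb ha hb,
      Equiv.Perm.smul_def]
  have hU (z : PuncturedPlane) : Φ (u ^ 5) • planeEmb z = planeEmb (dilation _ hΛ0 • z) := by
    rw [hΦ, Units.val_pow_eq_pow_val, hu, ringRep_bassCyclic_pow_planeEmb hc hΛ0,
      Equiv.Perm.smul_def]
  apply isFreePair_of_injective_lift
  have h := injective_lift_of_semiconj ![Φ (v ^ 8), Φ (u ^ 5)]
    ![shear _, dilation _ hΛ0] planeEmb planeEmb_injective
    (Fin.forall_fin_two.2 ⟨hV, hU⟩) (injective_lift_shear_dilation hτ hΛ hΛ0)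
  have hcomp : FreeGroup.lift ![Φ (v ^ 8), Φ (u ^ 5)] =
      Φ.comp (FreeGroup.lift ![v ^ 8, u ^ 5]) := by
    ext i : 1
    fin_cases i <;> simp
  rw [hcomp, MonoidHom.coe_comp] at h
  exact h.of_comp

end Main

theorem exists_isFreePair_alternatingGroup_five (a b c : alternatingGroup (Fin 5))
    (ha : (a : Equiv.Perm (Fin 5)) = c[0, 1] * c[2, 3])
    (hb : (b : Equiv.Perm (Fin 5)) = c[0, 2, 4])
    (hc : (c : Equiv.Perm (Fin 5)) = c[0, 1, 2, 3, 4]) :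
    ∃ u v : (MonoidAlgebra ℤ (alternatingGroup (Fin 5)))ˣ,
      (u : MonoidAlgebra ℤ (alternatingGroup (Fin 5))) = bassCyclic 2 4 c ∧
      (v : MonoidAlgebra ℤ (alternatingGroup (Fin 5))) = bicyclicBeta b a ∧
      ∃ s t : ℕ, 0 < s ∧ 0 < t ∧
        ((u ^ s : (MonoidAlgebra ℤ (alternatingGroup (Fin 5)))ˣ) :
          MonoidAlgebra ℤ (alternatingGroup (Fin 5))) = bassCyclic 2 (4 * s) c ∧
        IsFreePair (v ^ t) (u ^ s) := by
  have ho := orderOf_fiveCycle hc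
  refine ⟨bassUnit ho, bicyclicBetaUnit b a, rfl, rfl, 5, 8, by norm_num, by norm_num, ?_,
    isFreePair_bicyclicBeta_bassCyclic ha hb hc rfl rfl⟩
  rw [Units.val_pow_eq_pow_val]
  exact bassCyclic_two_four_pow ho 5

theorem hasBicyclicBassFreePair_alternatingGroup_five :
    HasBicyclicBassFreePair (alternatingGroup (Fin 5)) := by
  let a : alternatingGroup (Fin 5) := ⟨c[0, 1] * c[2, 3], by rw [Equiv.Perm.mem_alternatingGroup]; decide⟩
  let b : alternatingGroup (Fin 5) := ⟨c[0, 2, 4], by rw [Equiv.Perm.mem_alternatingGroup]; decide⟩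
  let c : alternatingGroup (Fin 5) := ⟨c[0, 1, 2, 3, 4], by rw [Equiv.Perm.mem_alternatingGroup]; decide⟩
  have ho : orderOf c = 5 := orderOf_fiveCycle rfl
  obtain ⟨u, v, -, hv, s, t, hs, ht, hus, h⟩ :=
    exists_isFreePair_alternatingGroup_five a b c rfl rfl rfl
  refine ⟨v, u ^ s, ⟨b, a, isOfFinOrder_of_finite a, .inl hv⟩,
    ⟨c, 2, 4 * s, isOfFinOrder_of_finite c, by norm_num, by omega, ?_, ?_, hus⟩, t, ht, h⟩
  · rw [ho]; decide
  · rw [ho]; exact Dvd.intro s rfl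

theorem mainTheorem6 :
    (∀ n : ℕ, HasBicyclicBassFreePair (alternatingGroup (Fin n)) ↔ 5 ≤ n) ∧
    (∀ n : ℕ, HasBicyclicBassFreePair (Equiv.Perm (Fin n)) ↔ 5 ≤ n) ∧
    -- the explicit pair in `ℤA₅`; the points `1, …, 5` are the elements `0, …, 4` of `Fin 5`
    (∀ a b c : alternatingGroup (Fin 5),
      (a : Equiv.Perm (Fin 5)) = c[0, 1] * c[2, 3] →
      (b : Equiv.Perm (Fin 5)) = c[0, 2, 4] →
      (c : Equiv.Perm (Fin 5)) = c[0, 1, 2, 3, 4] →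
      ∃ u v : (MonoidAlgebra ℤ (alternatingGroup (Fin 5)))ˣ,
        (u : MonoidAlgebra ℤ (alternatingGroup (Fin 5))) = bassCyclic 2 4 c ∧
        (v : MonoidAlgebra ℤ (alternatingGroup (Fin 5))) = bicyclicBeta b a ∧
        ∃ s t : ℕ, 0 < s ∧ 0 < t ∧
          ((u ^ s : (MonoidAlgebra ℤ (alternatingGroup (Fin 5)))ˣ) :
            MonoidAlgebra ℤ (alternatingGroup (Fin 5))) = bassCyclic 2 (4 * s) c ∧
          IsFreePair (v ^ t) (u ^ s)) := by
  have hA : ∀ n, 5 ≤ n → HasBicyclicBassFreePair (alternatingGroup (Fin n)) := fun n hn =>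
    hasBicyclicBassFreePair_alternatingGroup_five.map _ (alternatingGroupEmbedding_injective hn)
  refine ⟨fun n => ⟨fun h => ?_, hA n⟩, fun n => ⟨fun h => ?_, fun hn => ?_⟩,
    exists_isFreePair_alternatingGroup_five⟩
  · by_contra! hn
    refine not_hasBicyclicBassFreePair (fun σ => ?_) h
    rw [← Subgroup.orderOf_coe]
    exact orderOf_dvd_of_perm_fin hn _
  · by_contra! hn
    exact not_hasBicyclicBassFreePair (orderOf_dvd_of_perm_fin hn) h
  · exact (hA n hn).map _ (alternatingGroup (Fin n)).subtype_injective
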